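/- Let the nodes of a wireless network form a homogeneous Poisson point process $\phi=\{x_1,x_2,\dots\}\subset\mathbb{R}^2$ of density $\lambda>0$. In every time slot each node transmits independently with probability $p\in(0,1]$ (ALOHA). The power fading coefficients $h_{xz}(k)\ge 0$ (node $x$, receiver location $z$, slot $k$) are i.i.d. over nodes, receiver locations and slots, with the law of a random variable $h$ with $\mathbb{E}[h]=1$ and $\mathbb{E}[h^2]<\infty$; node locations, transmission decisions and fading coefficients are mutually independent. The path loss $g:\mathbb{R}^2\to[0,\infty)$ depends only on $\|x\|$, is non-increasing in $\|x\|$, satisfies $\int_0^\infty r\,g(r)\,\mathrm{d}r<\infty$, and does not vanish identically on $\mathbb{R}^2\setminus\{0\}$. Let $\phi_k\subset\phi$ be the set of transmitting nodes in slot $k$ and $$I_k(z)=\sum_{x\in\phi}\mathbf{1}(x\in\phi_k)\,h_{xz}(k)\,g(x-z)$$ the interference at $z$ in slot $k$. Then for every $z\in\mathbb{R}^2$ and every slot $k$ the sum converges almost surely and $I_k(z)$ has finite, nonzero variance, and for every $z$ and all slots $k\ne l$ the correlation coefficient of $I_k(z)$ and $I_l(z)$ (the temporal correlation coefficient) is $$\zeta_t=\frac{p}{\mathbb{E}[h^2]}.$$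 For Nakagami-$m$ fading, $m>0$, i.e. when $h$ has the Gamma distribution with shape $m$ and rate $m$, this equals $\zeta_t=\frac{pm}{m+1}$. In particular, $\zeta_t=p/2$ for Rayleigh fading ($m=1$, $h$ exponential with mean $1$), and under Nakagami-$m$ fading $\zeta_t\to p$ as $m\to\infty$, the value $p$ being that of $\zeta_t$ without fading ($h\equiv 1$). -/

import Mathlib

open MeasureTheory ProbabilityTheory Filter Topology
open scoped NNReal ENNReal

noncomputable section

/-- The plane with its Euclidean norm and Lebesgue measure. -/
abbrev Plane : Type := EuclideanSpace ℝ (Fin 2)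

/-- The number (with multiplicity, possibly infinite) of points of the sequence `X` in `A`. -/
def pointCount {Ω E : Type*} (X : ℕ → Ω → E) (A : Set E) (ω : Ω) : ℝ≥0∞ :=
  ∑' n, A.indicator (fun _ => (1 : ℝ≥0∞)) (X n ω)

/-- The random points `X 0, X 1, …` enumerate a Poisson point process with intensity measure `ν`
(of infinite total mass, so that there are infinitely many points): the number of points in a set
of finite `ν`-measure is Poisson distributed with mean the measure of that set, and the numbers of
points in disjoint sets are independent. -/
structure IsPoissonPointProcess {Ω E : Type*} [MeasurableSpace Ω] [MeasurableSpace E]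
    (X : ℕ → Ω → E) (ν : Measure E) (P : Measure Ω) : Prop where
  measurable : ∀ n, Measurable (X n)
  law_count : ∀ A : Set E, MeasurableSet A → ν A ≠ ∞ →
    HasLaw (pointCount X A) ((poissonMeasure (ν A).toNNReal).map (fun n : ℕ => (n : ℝ≥0∞))) P
  indep_count : ∀ (j : ℕ) (A : Fin j → Set E), (∀ i, MeasurableSet (A i)) →
    Pairwise (fun i i' => Disjoint (A i) (A i')) →
    iIndepFun (fun i => pointCount X (A i)) P

/-- A path loss function `x ↦ g ‖x‖` on the plane, given by its radial profile `g`: nonnegative,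
decreasing in the distance, and integrable over the plane in polar coordinates. -/
structure IsPathLoss (g : ℝ → ℝ) : Prop where
  nonneg : ∀ r, 0 ≤ r → 0 ≤ g r
  antitone : AntitoneOn g (Set.Ici 0)
  integrable : IntegrableOn (fun r => r * g r) (Set.Ioi 0)

/-- `F` is the law of a (power) fading coefficient `h ≥ 0` with `𝔼[h] = 1` and `𝔼[h²] < ∞`. -/
structure IsUnitMeanFading (F : Measure ℝ) : Prop where
  prob : IsProbabilityMeasure F
  nonneg : ∀ᵐ x ∂F, 0 ≤ x
  mean : ∫ x, x ∂F = 1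
  memLp : MemLp (fun x : ℝ => x) 2 F

/-- The law of the power fading coefficient under Nakagami-`m` fading, with distribution function
`1 - Γ(m, m x) / Γ(m)`: the Gamma law with shape `m` and rate `m`. -/
def nakagamiPower (m : ℝ) : Measure ℝ := gammaMeasure m m

/-- The law of the power fading coefficient under Rayleigh fading: exponential with mean one. -/
def rayleighPower : Measure ℝ := expMeasure 1

/-- The law of the power fading coefficient without fading: constantly one. -/
def noFading : Measure ℝ := Measure.dirac 1

/-- An ad hoc network in the plane: the nodes form a homogeneous Poisson point process of density
`lam`; in every time slot each node transmits with probability `p` (ALOHA); the power fading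
coefficients have law `F`. Decisions to transmit are independent over nodes and slots, fading
coefficients are independent over nodes, receiver locations and slots, and node locations,
decisions and fading coefficients are mutually independent. -/
structure AlohaNetwork (lam : ℝ≥0) (p : ℝ) (F : Measure ℝ) where
  /-- the sample space -/
  Ω : Type*
  [mΩ : MeasurableSpace Ω]
  /-- the probability measure -/
  P : Measure Ω
  [prob : IsProbabilityMeasure P]
  /-- `node n` is the location of the `n`-th node -/
  node : ℕ → Ω → Plane
  /-- `transmits n k` says whether the `n`-th node transmits in slot `k` -/
  transmits : ℕ → ℕ → Ω → Bool
  /-- `fading n z k` is the fading coefficient from the `n`-th node to location `z` in slot `k` -/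
  fading : ℕ → Plane → ℕ → Ω → ℝ
  poisson : IsPoissonPointProcess node (lam • (volume : Measure Plane)) P
  measurable_transmits : ∀ n k, Measurable (transmits n k)
  prob_transmits : ∀ n k, P {ω | transmits n k ω = true} = ENNReal.ofReal p
  indep_transmits : iIndepFun (fun i : ℕ × ℕ => transmits i.1 i.2) P
  measurable_fading : ∀ n z k, Measurable (fading n z k)
  law_fading : ∀ n z k, HasLaw (fading n z k) F P
  indep_fading : iIndepFun (fun i : ℕ × Plane × ℕ => fading i.1 i.2.1 i.2.2) P
  indep_transmits_fading :
    IndepFun (fun ω n k => transmits n k ω) (fun ω n z k => fading n z k ω) P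
  indep_node : IndepFun (fun ω n => node n ω)
    (fun ω => ((fun n k => transmits n k ω : ℕ → ℕ → Bool),
      (fun n z k => fading n z k ω : ℕ → Plane → ℕ → ℝ))) P

attribute [instance] AlohaNetwork.mΩ AlohaNetwork.prob

namespace AlohaNetwork

variable {lam : ℝ≥0} {p : ℝ} {F : Measure ℝ}

/-- The power received at `z` in slot `k` from the `n`-th node (zero if it does not transmit). -/
def received (N : AlohaNetwork lam p F) (g : ℝ → ℝ) (k : ℕ) (z : Plane) (n : ℕ) (ω : N.Ω) : ℝ :=
  if N.transmits n k ω = true then N.fading n z k ω * g ‖N.node n ω - z‖ else 0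

/-- The interference at `z` in slot `k`. -/
def interference (N : AlohaNetwork lam p F) (g : ℝ → ℝ) (k : ℕ) (z : Plane) (ω : N.Ω) : ℝ :=
  ∑' n, N.received g k z n ω

/-- The (Pearson) correlation coefficient of the interferences at `u` in slot `k` and at `v`
in slot `l`. -/
def correlation (N : AlohaNetwork lam p F) (g : ℝ → ℝ) (k l : ℕ) (u v : Plane) : ℝ :=
  cov[N.interference g k u, N.interference g l v; N.P] /
    (√(Var[N.interference g k u; N.P]) * √(Var[N.interference g l v; N.P]))

/-- At every location, the interference in each slot is an almost surely convergent sum with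
finite nonzero variance, and the interferences in any two different slots have correlation
coefficient `ζ`. -/
def HasTemporalCorrelation (N : AlohaNetwork lam p F) (g : ℝ → ℝ) (ζ : ℝ) : Prop :=
  ∀ z : Plane,
    (∀ k, (∀ᵐ ω ∂N.P, Summable (fun n => N.received g k z n ω)) ∧
      MemLp (N.interference g k z) 2 N.P ∧ 0 < Var[N.interference g k z; N.P]) ∧
    ∀ k l, k ≠ l → N.correlation g k l z z = ζ

end AlohaNetwork

end

/-! The interference is a shot noise `∑ aₙ(k) f(Xₙ)` with `f(x) = g ‖x - z‖` and marks `aₙ(k)` =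
(transmission indicator) × (fading), independent of the locations. In the product of the
interferences of slots `k` and `l`, the off-diagonal pairs of nodes contribute `p² (λ∫g)²`, because
distinct points have second factorial moment measure `ν ⊗ ν` and marks of distinct nodes are
uncorrelated. This is exactly the product of the two means, so the covariance is the diagonal part
`𝔼[aₙ(k) aₙ(l)] · λ∫g²`. The mark factor is `p 𝔼[h²]` if `k = l` and `p²` otherwise, hence the ratio
`p / 𝔼[h²]`; `λ` and `g` cancel.

The moment measures are `IsPoissonPointProcess.firstMoment_eq` and `secondFactorialMoment_eq`; they
yield the Campbell formula `lintegral_tsum_mul_mul_tsum_mul`, then `covariance_interference`. Sums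
are handled in `ℝ≥0∞`, where Tonelli needs no integrability, and become real once their moments are
known to be finite. -/

/-! ### Double series and moments of the Poisson law. -/

/-- A double series splits into its off-diagonal part and its diagonal. -/
theorem ENNReal.tsum_tsum_eq_offDiag_add_diag {ι : Type*} [DecidableEq ι] (F : ι → ι → ℝ≥0∞) :
    ∑' n, ∑' m, F n m = ∑' n, ∑' m, (if n = m then 0 else F n m) + ∑' n, F n n := by
  rw [← ENNReal.tsum_add]
  congr 1 with n
  have h : ∀ m, F n m = (if n = m then 0 else F n m) + if m = n then F n n else 0 := by
    intro m
    by_cases h : n = m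
    · subst h; simp
    · simp [h, Ne.symm h]
  rw [tsum_congr h, ENNReal.tsum_add, tsum_ite_eq]

theorem ENNReal.tsum_mul_tsum {ι κ : Type*} (a : ι → ℝ≥0∞) (b : κ → ℝ≥0∞) :
    (∑' n, a n) * ∑' m, b m = ∑' n, ∑' m, a n * b m := by
  simp_rw [ENNReal.tsum_mul_left, ENNReal.tsum_mul_right]

/-- Size biasing: `n · rⁿ/n! = r · rⁿ⁻¹/(n-1)!`, and the term `n = 0` drops out. The choices `f = 1`
and `f n = n` give the first two moments. -/
theorem lintegral_natCast_mul_poissonMeasure (r : ℝ≥0) (f : ℕ → ℝ≥0∞) :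
    ∫⁻ n, (n : ℝ≥0∞) * f n ∂poissonMeasure r = r * ∫⁻ n, f (n + 1) ∂poissonMeasure r := by
  simp only [poissonMeasure, lintegral_sum_measure, lintegral_smul_measure, lintegral_dirac,
    smul_eq_mul]
  rw [_root_.tsum_eq_zero_add' ENNReal.summable, ← ENNReal.tsum_mul_left]
  simp only [Nat.cast_zero, zero_mul, mul_zero, zero_add]
  congr 1 with n
  rw [← mul_assoc, ← mul_assoc, ← ENNReal.ofReal_coe_nnreal, ← ENNReal.ofReal_natCast,
    ← ENNReal.ofReal_mul (by positivity), ← ENNReal.ofReal_mul (by positivity)]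
  congr 2
  rw [Nat.factorial_succ]
  push_cast
  field_simp
  ring

theorem lintegral_natCast_poissonMeasure (r : ℝ≥0) :
    ∫⁻ n, (n : ℝ≥0∞) ∂poissonMeasure r = r := by
  simpa using lintegral_natCast_mul_poissonMeasure r (fun _ => 1)

theorem lintegral_natCast_mul_self_poissonMeasure (r : ℝ≥0) :
    ∫⁻ n, (n : ℝ≥0∞) * n ∂poissonMeasure r = r * r + r := by
  rw [lintegral_natCast_mul_poissonMeasure r (fun n => (n : ℝ≥0∞))]
  simp only [Nat.cast_add, Nat.cast_one]
  rw [lintegral_add_right _ measurable_const, lintegral_natCast_poissonMeasure]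
  simp [mul_add]

theorem pointCount_union {Ω E : Type*} {X : ℕ → Ω → E} {A B : Set E} (h : Disjoint A B) (ω : Ω) :
    pointCount X (A ∪ B) ω = pointCount X A ω + pointCount X B ω := by
  simp only [pointCount, ← ENNReal.tsum_add]
  congr 1 with n
  rw [Set.indicator_union_of_disjoint h]

theorem lintegral_tsum_tsum {α : Type*} [MeasurableSpace α] {μ : Measure α}
    {F : ℕ → ℕ → α → ℝ≥0∞} (hF : ∀ n m, Measurable (F n m)) :
    ∫⁻ x, ∑' n, ∑' m, F n m x ∂μ = ∑' n, ∑' m, ∫⁻ x, F n m x ∂μ := by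
  rw [lintegral_tsum fun n => (Measurable.tsum (hF n)).aemeasurable]
  congr 1 with n
  exact lintegral_tsum fun m => (hF n m).aemeasurable

/-! ### The π-system of sets of finite measure. -/

section FiniteMeasureSets

variable {E : Type*} [MeasurableSpace E] (ν : Measure E)

/-- Counts have a prescribed law only on sets of finite `ν`-measure; moment measures are identified
on this π-system. -/
theorem isPiSystem_measurableSet_finite : IsPiSystem {A : Set E | MeasurableSet A ∧ ν A ≠ ∞} :=
  fun _ hA _ hB _ => ⟨hA.1.inter hB.1,
    ((measure_mono Set.inter_subset_left).trans_lt hA.2.lt_top).ne⟩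

/-- A σ-finite measure is spanned by its measurable sets of finite measure. -/
noncomputable def finiteSpanningSets_finite [SigmaFinite ν] :
    ν.FiniteSpanningSetsIn {A | MeasurableSet A ∧ ν A ≠ ∞} where
  set := spanningSets ν
  set_mem n := ⟨measurableSet_spanningSets ν n, (measure_spanningSets_lt_top ν n).ne⟩
  finite := measure_spanningSets_lt_top ν
  spanning := iUnion_spanningSets ν

theorem generateFrom_measurableSet_finite [SigmaFinite ν] :
    MeasurableSpace.generateFrom {A : Set E | MeasurableSet A ∧ ν A ≠ ∞} = ‹_› := by
  refine le_antisymm (MeasurableSpace.generateFrom_le fun A hA => hA.1) fun A hA => ?_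
  rw [← Set.inter_univ A, ← iUnion_spanningSets ν, Set.inter_iUnion]
  refine MeasurableSet.iUnion fun n => MeasurableSpace.measurableSet_generateFrom
    ⟨hA.inter (measurableSet_spanningSets ν n), ?_⟩
  exact ((measure_mono Set.inter_subset_right).trans_lt (measure_spanningSets_lt_top ν n)).ne

end FiniteMeasureSets

/-! ### Moment measures of a Poisson point process. -/

section PointProcess

variable {Ω E : Type*} [MeasurableSpace Ω] [MeasurableSpace E] {X : ℕ → Ω → E} {ν : Measure E}
  {P : Measure Ω}

theorem measurable_pointCount (hX : ∀ n, Measurable (X n)) {A : Set E} (hA : MeasurableSet A) :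
    Measurable (pointCount X A) :=
  Measurable.tsum fun n => (measurable_const.indicator hA).comp (hX n)

/-- The first moment measure of the point process `X 0, X 1, …`. -/
noncomputable def firstMoment (X : ℕ → Ω → E) (P : Measure Ω) : Measure E :=
  Measure.sum fun n => P.map (X n)

/-- The second factorial moment measure of the point process `X 0, X 1, …`. -/
noncomputable def secondFactorialMoment (X : ℕ → Ω → E) (P : Measure Ω) : Measure (E × E) :=
  Measure.sum fun n => Measure.sum fun m =>
    if n = m then 0 else P.map (fun ω => (X n ω, X m ω))

theorem lintegral_firstMoment (hX : ∀ n, Measurable (X n)) {f : E → ℝ≥0∞} (hf : Measurable f) :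
    ∫⁻ x, f x ∂firstMoment X P = ∑' n, ∫⁻ ω, f (X n ω) ∂P := by
  rw [firstMoment, lintegral_sum_measure]
  congr 1 with n
  rw [lintegral_map hf (hX n)]

theorem lintegral_secondFactorialMoment (hX : ∀ n, Measurable (X n)) {f : E × E → ℝ≥0∞}
    (hf : Measurable f) :
    ∫⁻ x, f x ∂secondFactorialMoment X P =
      ∑' n, ∑' m, if n = m then 0 else ∫⁻ ω, f (X n ω, X m ω) ∂P := by
  rw [secondFactorialMoment, lintegral_sum_measure]
  congr 1 with n
  rw [lintegral_sum_measure]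
  congr 1 with m
  split_ifs
  · simp
  · rw [lintegral_map hf ((hX n).prodMk (hX m))]

theorem firstMoment_apply (hX : ∀ n, Measurable (X n)) {A : Set E} (hA : MeasurableSet A) :
    firstMoment X P A = ∫⁻ ω, pointCount X A ω ∂P := by
  have mA : ∀ n, Measurable fun ω => A.indicator (fun _ => (1 : ℝ≥0∞)) (X n ω) :=
    fun n => (measurable_const.indicator hA).comp (hX n)
  simp only [pointCount]
  rw [lintegral_tsum fun n => (mA n).aemeasurable,
    ← lintegral_firstMoment hX (measurable_const.indicator hA), lintegral_indicator hA]
  simp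

/-- The product of counts is a sum over pairs of indices; a diagonal pair contributes `1_A 1_B =
1_{A ∩ B}` at a single point. -/
theorem secondFactorialMoment_prod_add (hX : ∀ n, Measurable (X n)) {A B : Set E}
    (hA : MeasurableSet A) (hB : MeasurableSet B) :
    secondFactorialMoment X P (A ×ˢ B) + firstMoment X P (A ∩ B) =
      ∫⁻ ω, pointCount X A ω * pointCount X B ω ∂P := by
  have mA : ∀ n, Measurable fun ω => A.indicator (fun _ => (1 : ℝ≥0∞)) (X n ω) :=
    fun n => (measurable_const.indicator hA).comp (hX n)
  have mB : ∀ n, Measurable fun ω => B.indicator (fun _ => (1 : ℝ≥0∞)) (X n ω) :=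
    fun n => (measurable_const.indicator hB).comp (hX n)
  have mAB : ∀ n, Measurable fun ω => (A ∩ B).indicator (fun _ => (1 : ℝ≥0∞)) (X n ω) :=
    fun n => (measurable_const.indicator (hA.inter hB)).comp (hX n)
  have h1 : ∀ {α : Type _} [MeasurableSpace α] (m : Measure α) {C : Set α}, MeasurableSet C →
      m C = ∫⁻ x, C.indicator (fun _ => (1 : ℝ≥0∞)) x ∂m := by
    intro α _ m C hC
    rw [lintegral_indicator hC]; simp
  rw [h1 _ (hA.prod hB), lintegral_secondFactorialMoment hX (measurable_const.indicator
    (hA.prod hB)), firstMoment_apply hX (hA.inter hB)]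
  simp only [pointCount]
  simp_rw [ENNReal.tsum_mul_tsum]
  rw [lintegral_tsum (fun n => (mAB n).aemeasurable),
    lintegral_tsum_tsum fun n m => (mA n).fun_mul (mB m)]
  rw [ENNReal.tsum_tsum_eq_offDiag_add_diag fun n m => ∫⁻ ω, A.indicator (fun _ => (1 : ℝ≥0∞))
    (X n ω) * B.indicator (fun _ => (1 : ℝ≥0∞)) (X m ω) ∂P]
  classical
  congr! 9 <;> simp only [Set.indicator_apply, Set.mem_prod, Set.mem_inter_iff] <;>
    split_ifs <;> simp_all

namespace IsPoissonPointProcess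

theorem lintegral_pointCount (h : IsPoissonPointProcess X ν P) {A : Set E} (hA : MeasurableSet A)
    (hν : ν A ≠ ∞) : ∫⁻ ω, pointCount X A ω ∂P = ν A := by
  rw [(h.law_count A hA hν).lintegral_comp (f := fun x => x) aemeasurable_id,
    lintegral_map measurable_id' .of_discrete, lintegral_natCast_poissonMeasure,
    ENNReal.coe_toNNReal hν]

theorem lintegral_pointCount_mul_self (h : IsPoissonPointProcess X ν P) {A : Set E}
    (hA : MeasurableSet A) (hν : ν A ≠ ∞) :
    ∫⁻ ω, pointCount X A ω * pointCount X A ω ∂P = ν A * ν A + ν A := by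
  rw [(h.law_count A hA hν).lintegral_comp (f := fun x => x * x) (by fun_prop),
    lintegral_map (by fun_prop) .of_discrete, lintegral_natCast_mul_self_poissonMeasure,
    ENNReal.coe_toNNReal hν]

theorem lintegral_pointCount_mul_of_disjoint (h : IsPoissonPointProcess X ν P) {A B : Set E}
    (hA : MeasurableSet A) (hB : MeasurableSet B) (hνA : ν A ≠ ∞) (hνB : ν B ≠ ∞)
    (hAB : Disjoint A B) :
    ∫⁻ ω, pointCount X A ω * pointCount X B ω ∂P = ν A * ν B := by
  have hi := h.indep_count 2 ![A, B] (by simp [Fin.forall_fin_two, hA, hB]) (by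
    intro i j hij
    fin_cases i <;> fin_cases j <;> simp_all [disjoint_comm])
  have := hi.indepFun (i := 0) (j := 1) (by simp)
  have := lintegral_mul_eq_lintegral_mul_lintegral_of_indepFun
    (measurable_pointCount h.measurable hA) (measurable_pointCount h.measurable hB) this
  rw [← h.lintegral_pointCount hA hνA, ← h.lintegral_pointCount hB hνB, ← this]
  rfl

/-- Cut into `A \ B`, `B \ A` and `A ∩ B`: disjoint pieces have independent counts, and only the
squared count of `A ∩ B` adds the extra `ν (A ∩ B)`. -/
theorem lintegral_pointCount_mul (h : IsPoissonPointProcess X ν P) {A B : Set E}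
    (hA : MeasurableSet A) (hB : MeasurableSet B) (hνA : ν A ≠ ∞) (hνB : ν B ≠ ∞) :
    ∫⁻ ω, pointCount X A ω * pointCount X B ω ∂P = ν A * ν B + ν (A ∩ B) := by
  have hfin : ∀ {C D : Set E}, C ⊆ D → ν D ≠ ∞ → ν C ≠ ∞ :=
    fun hCD hD => ((measure_mono hCD).trans_lt hD.lt_top).ne
  have h1 := hfin (Set.sdiff_subset (s := A) (t := B)) hνA
  have h2 := hfin (Set.sdiff_subset (s := B) (t := A)) hνB
  have h3 := hfin (Set.inter_subset_left (s := A) (t := B)) hνA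
  have m1 := hA.diff hB
  have m2 := hB.diff hA
  have m3 := hA.inter hB
  have d1 : Disjoint (A \ B) (A ∩ B) := Set.disjoint_sdiff_inter
  have d2 : Disjoint (B \ A) (A ∩ B) := by rw [Set.inter_comm]; exact Set.disjoint_sdiff_inter
  have d3 : Disjoint (A \ B) (B \ A) := disjoint_sdiff_sdiff
  have eA : A = (A \ B) ∪ (A ∩ B) := (Set.sdiff_union_inter A B).symm
  have eB : B = (B \ A) ∪ (A ∩ B) := by
    conv_lhs => rw [← Set.sdiff_union_inter B A, Set.inter_comm]
  have c1 := measurable_pointCount h.measurable m1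
  have c2 := measurable_pointCount h.measurable m2
  have c3 := measurable_pointCount h.measurable m3
  have hpA : ∀ ω, pointCount X A ω = pointCount X (A \ B) ω + pointCount X (A ∩ B) ω := by
    intro ω; rw [← pointCount_union d1, ← eA]
  have hpB : ∀ ω, pointCount X B ω = pointCount X (B \ A) ω + pointCount X (A ∩ B) ω := by
    intro ω; rw [← pointCount_union d2, ← eB]
  have hνA' : ν A = ν (A \ B) + ν (A ∩ B) := by rw [← measure_union d1 m3, ← eA]
  have hνB' : ν B = ν (B \ A) + ν (A ∩ B) := by rw [← measure_union d2 m3, ← eB]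
  simp_rw [hpA, hpB, add_mul, mul_add]
  rw [lintegral_add_left (by fun_prop), lintegral_add_left (by fun_prop),
    lintegral_add_left (by fun_prop), h.lintegral_pointCount_mul_of_disjoint m1 m2 h1 h2 d3,
    h.lintegral_pointCount_mul_of_disjoint m1 m3 h1 h3 d1,
    h.lintegral_pointCount_mul_of_disjoint m3 m2 h3 h2 d2.symm,
    h.lintegral_pointCount_mul_self m3 h3, hνA', hνB']
  ring

/-- Campbell's formula for the intensity measure. -/
theorem firstMoment_eq [SigmaFinite ν] (h : IsPoissonPointProcess X ν P) :
    firstMoment X P = ν :=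
  ((finiteSpanningSets_finite ν).ext (generateFrom_measurableSet_finite ν).symm
    (isPiSystem_measurableSet_finite ν) fun A hA => by
      rw [firstMoment_apply h.measurable hA.1, h.lintegral_pointCount hA.1 hA.2]).symm

/-- On rectangles, the finite diagonal term `ν (A ∩ B)` cancels from both expressions for the mixed
moment of the counts, leaving `ν A * ν B`. -/
theorem secondFactorialMoment_eq [SigmaFinite ν] (h : IsPoissonPointProcess X ν P) :
    secondFactorialMoment X P = ν.prod ν := by
  refine (Measure.prod_eq_generateFrom (generateFrom_measurableSet_finite ν)
    (generateFrom_measurableSet_finite ν) (isPiSystem_measurableSet_finite ν)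
    (isPiSystem_measurableSet_finite ν) (finiteSpanningSets_finite ν)
    (finiteSpanningSets_finite ν) fun A hA B hB => ?_).symm
  have := secondFactorialMoment_prod_add (P := P) h.measurable hA.1 hB.1
  rw [h.lintegral_pointCount_mul hA.1 hB.1 hA.2 hB.2, h.firstMoment_eq] at this
  exact (ENNReal.add_left_inj
    ((measure_mono Set.inter_subset_left).trans_lt hA.2.lt_top).ne).1 this

end IsPoissonPointProcess

end PointProcess

/-! ### Campbell's formulas for marked sums. -/

section ShotNoise

variable {Ω E : Type*} [MeasurableSpace Ω] [MeasurableSpace E] {X : ℕ → Ω → E} {ν : Measure E}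
  {P : Measure Ω} [SigmaFinite ν] {f : E → ℝ≥0∞}

namespace IsPoissonPointProcess

/-- Campbell's formula for the mean of a shot noise process with independent marks `a`. -/
theorem lintegral_tsum_mul (h : IsPoissonPointProcess X ν P) (hf : Measurable f)
    {a : ℕ → Ω → ℝ≥0∞} (ha : ∀ n, Measurable (a n)) {α : ℝ≥0∞} (hα : ∀ n, ∫⁻ ω, a n ω ∂P = α)
    (hi : IndepFun (fun ω n => X n ω) (fun ω n => a n ω) P) :
    ∫⁻ ω, ∑' n, a n ω * f (X n ω) ∂P = α * ∫⁻ x, f x ∂ν := by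
  have mf : ∀ n, Measurable fun ω => f (X n ω) := fun n => hf.comp (h.measurable n)
  rw [lintegral_tsum fun n => ((ha n).fun_mul (mf n)).aemeasurable, ← h.firstMoment_eq,
    lintegral_firstMoment h.measurable hf, ← ENNReal.tsum_mul_left]
  congr 1 with n
  rw [← hα n]
  exact lintegral_mul_eq_lintegral_mul_lintegral_of_indepFun (ha n) (mf n)
    (hi.symm.comp (φ := fun u : ℕ → ℝ≥0∞ => u n) (ψ := fun x : ℕ → E => f (x n))
      (by fun_prop) (by fun_prop))

/-- Campbell's formula for the mixed second moment of two shot noise processes with independent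
marks `a` and `b`. -/
theorem lintegral_tsum_mul_mul_tsum_mul (h : IsPoissonPointProcess X ν P) (hf : Measurable f)
    {a b : ℕ → Ω → ℝ≥0∞} (ha : ∀ n, Measurable (a n)) (hb : ∀ n, Measurable (b n))
    {β γ : ℝ≥0∞} (hβ : ∀ n, ∫⁻ ω, a n ω * b n ω ∂P = β)
    (hγ : ∀ n m, n ≠ m → ∫⁻ ω, a n ω * b m ω ∂P = γ)
    (hi : IndepFun (fun ω n => X n ω) (fun ω n => (a n ω, b n ω)) P) :
    ∫⁻ ω, (∑' n, a n ω * f (X n ω)) * ∑' n, b n ω * f (X n ω) ∂P =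
      β * ∫⁻ x, f x * f x ∂ν + γ * ((∫⁻ x, f x ∂ν) * ∫⁻ x, f x ∂ν) := by
  have mf : ∀ n, Measurable fun ω => f (X n ω) := fun n => hf.comp (h.measurable n)
  -- Marks and locations separate for every pair, the diagonal included, since the whole sequences
  -- are independent.
  have key : ∀ n m, ∫⁻ ω, a n ω * f (X n ω) * (b m ω * f (X m ω)) ∂P =
      (∫⁻ ω, a n ω * b m ω ∂P) * ∫⁻ ω, f (X n ω) * f (X m ω) ∂P := by
    intro n m
    rw [lintegral_congr fun ω => mul_mul_mul_comm _ _ _ _]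
    exact lintegral_mul_eq_lintegral_mul_lintegral_of_indepFun ((ha n).mul (hb m))
      ((mf n).mul (mf m)) (hi.symm.comp (φ := fun u : ℕ → ℝ≥0∞ × ℝ≥0∞ => (u n).1 * (u m).2)
        (ψ := fun x : ℕ → E => f (x n) * f (x m)) (by fun_prop) (by fun_prop))
  simp_rw [ENNReal.tsum_mul_tsum]
  rw [lintegral_tsum_tsum fun n m => ((ha n).fun_mul (mf n)).fun_mul ((hb m).fun_mul (mf m)),
    ENNReal.tsum_tsum_eq_offDiag_add_diag, add_comm]
  congr 1
  · have := h.firstMoment_eq ▸ lintegral_firstMoment (P := P) h.measurable (hf.fun_mul hf)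
    rw [this, ← ENNReal.tsum_mul_left]
    congr 1 with n
    rw [key, hβ]
  · rw [← lintegral_prod_mul hf.aemeasurable hf.aemeasurable, ← h.secondFactorialMoment_eq,
      lintegral_secondFactorialMoment h.measurable (by fun_prop), ← ENNReal.tsum_mul_left]
    congr 1 with n
    rw [← ENNReal.tsum_mul_left]
    congr 1 with m
    split_ifs with hnm
    · simp
    · rw [key, hγ n m hnm]

end IsPoissonPointProcess

end ShotNoise

/-! ### From extended nonnegative moments to real covariances. -/

theorem memLp_two_toReal {Ω : Type*} [MeasurableSpace Ω] {P : Measure Ω} {S : Ω → ℝ≥0∞}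
    (hS : AEMeasurable S P) (h2 : ∫⁻ ω, S ω * S ω ∂P ≠ ∞) :
    MemLp (fun ω => (S ω).toReal) 2 P := by
  refine (memLp_two_iff_integrable_sq hS.ennreal_toReal.aestronglyMeasurable).2 ?_
  have := integrable_toReal_of_lintegral_ne_top (hS.mul hS) h2
  simpa [pow_two] using this

/-- The covariance of the real parts of two `ℝ≥0∞`-valued random variables. -/
theorem covariance_toReal {Ω : Type*} [MeasurableSpace Ω] {P : Measure Ω} [IsProbabilityMeasure P]
    {S T : Ω → ℝ≥0∞} (hS : AEMeasurable S P) (hT : AEMeasurable T P)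
    (hS2 : ∫⁻ ω, S ω * S ω ∂P ≠ ∞) (hT2 : ∫⁻ ω, T ω * T ω ∂P ≠ ∞)
    (hST : ∫⁻ ω, S ω * T ω ∂P ≠ ∞) (hS1 : ∫⁻ ω, S ω ∂P ≠ ∞) (hT1 : ∫⁻ ω, T ω ∂P ≠ ∞) :
    cov[fun ω => (S ω).toReal, fun ω => (T ω).toReal; P] =
      (∫⁻ ω, S ω * T ω ∂P).toReal - (∫⁻ ω, S ω ∂P).toReal * (∫⁻ ω, T ω ∂P).toReal := by
  rw [covariance_eq_sub (memLp_two_toReal hS hS2) (memLp_two_toReal hT hT2)]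
  rw [← integral_toReal hS (ae_lt_top' hS hS1), ← integral_toReal hT (ae_lt_top' hT hT1),
    ← integral_toReal (hS.fun_mul hT) (ae_lt_top' (hS.fun_mul hT) hST)]
  simp

theorem covariance_congr_ae {Ω : Type*} [MeasurableSpace Ω] {P : Measure Ω} {X X' Y Y' : Ω → ℝ}
    (hX : X =ᵐ[P] X') (hY : Y =ᵐ[P] Y') : cov[X, Y; P] = cov[X', Y'; P] := by
  rw [covariance, covariance, integral_congr_ae hX, integral_congr_ae hY]
  refine integral_congr_ae ?_
  filter_upwards [hX, hY] with ω h1 h2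
  rw [h1, h2]

/-! ### Integrals of the path loss. -/

section PathLoss

variable {g : ℝ → ℝ}

namespace IsPathLoss

theorem measurable_ofReal_norm (hg : IsPathLoss g) :
    Measurable fun x : Plane => ENNReal.ofReal (g ‖x‖) := by
  -- Freezing `g` at `g 0` on negative arguments makes it antitone on all of `ℝ`, hence measurable;
  -- norms do not see the change.
  have h : Antitone fun r => g (max r 0) := fun r s hrs =>
    hg.antitone (le_max_right r 0) (le_max_right s 0) (max_le_max_right 0 hrs)
  have := (h.measurable.comp (measurable_norm (α := Plane))).ennreal_ofReal
  simpa [Function.comp_def] using this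

theorem integrable_norm (hg : IsPathLoss g) : Integrable fun x : Plane => g ‖x‖ := by
  rw [integrable_fun_norm_addHaar]
  simpa using hg.integrable

theorem lintegral_ne_top (hg : IsPathLoss g) :
    ∫⁻ x : Plane, ENNReal.ofReal (g ‖x‖) ≠ ∞ :=
  Integrable.lintegral_lt_top hg.integrable_norm |>.ne

/-- Since `g` is bounded by the finite value `g 0`, `g² ≤ g 0 · g`. -/
theorem lintegral_mul_self_ne_top (hg : IsPathLoss g) :
    ∫⁻ x : Plane, ENNReal.ofReal (g ‖x‖) * ENNReal.ofReal (g ‖x‖) ≠ ∞ := by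
  refine ((lintegral_mono fun x => mul_le_mul_left (ENNReal.ofReal_le_ofReal
    (hg.antitone Set.self_mem_Ici (norm_nonneg x) (norm_nonneg x))) _).trans_lt ?_).ne
  rw [lintegral_const_mul _ hg.measurable_ofReal_norm]
  exact ENNReal.mul_lt_top ENNReal.ofReal_lt_top hg.lintegral_ne_top.lt_top

/-- By monotonicity `g ≥ g r > 0` on the ball of radius `r`. -/
theorem lintegral_mul_self_pos (hg : IsPathLoss g) (hg0 : ∃ r, 0 < r ∧ 0 < g r) :
    0 < ∫⁻ x : Plane, ENNReal.ofReal (g ‖x‖) * ENNReal.ofReal (g ‖x‖) := by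
  obtain ⟨r, hr, hgr⟩ := hg0
  rw [lintegral_pos_iff_support (hg.measurable_ofReal_norm.fun_mul hg.measurable_ofReal_norm)]
  refine (Metric.measure_ball_pos volume (0 : Plane) hr).trans_le (measure_mono fun x hx => ?_)
  have hx : ‖x‖ ≤ r := (mem_ball_zero_iff.1 hx).le
  have := hgr.trans_le (hg.antitone (norm_nonneg x) hr.le hx)
  simp [this]

end IsPathLoss

end PathLoss

/-! ### Moments of the fading law. -/

namespace IsUnitMeanFading

variable {F : Measure ℝ}

theorem integrable_sq (hF : IsUnitMeanFading F) : Integrable (fun x : ℝ => x ^ 2) F :=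
  (memLp_two_iff_integrable_sq aestronglyMeasurable_id).1 hF.memLp

theorem lintegral_ofReal (hF : IsUnitMeanFading F) : ∫⁻ x, ENNReal.ofReal x ∂F = 1 := by
  have := hF.prob
  rw [← ofReal_integral_eq_lintegral_ofReal (hF.memLp.integrable one_le_two) hF.nonneg, hF.mean,
    ENNReal.ofReal_one]

theorem lintegral_ofReal_mul_self (hF : IsUnitMeanFading F) :
    ∫⁻ x, ENNReal.ofReal x * ENNReal.ofReal x ∂F = ENNReal.ofReal (∫ x, x ^ 2 ∂F) := by
  rw [ofReal_integral_eq_lintegral_ofReal hF.integrable_sq (ae_of_all _ fun x => sq_nonneg x)]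
  refine lintegral_congr_ae (hF.nonneg.mono fun x hx => ?_)
  simp only [pow_two, ENNReal.ofReal_mul hx]

theorem one_le_integral_sq (hF : IsUnitMeanFading F) : 1 ≤ ∫ x, x ^ 2 ∂F := by
  have := hF.prob
  have h := variance_nonneg (fun x : ℝ => x) F
  rw [variance_eq_sub hF.memLp, hF.mean] at h
  simpa using h

end IsUnitMeanFading

/-! ### Moments and independence of the marks. -/

namespace AlohaNetwork

variable {lam : ℝ≥0} {p : ℝ} {F : Measure ℝ} (N : AlohaNetwork lam p F)

/-- The indicator that the `n`-th node transmits in slot `k`. -/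
noncomputable def active (n k : ℕ) (ω : N.Ω) : ℝ≥0∞ := if N.transmits n k ω = true then 1 else 0

/-- The weight with which the `n`-th node contributes to the interference at `z` in slot `k`. -/
noncomputable def mark (k : ℕ) (z : Plane) (n : ℕ) (ω : N.Ω) : ℝ≥0∞ :=
  N.active n k ω * ENNReal.ofReal (N.fading n z k ω)

/-- The interference at `z` in slot `k` as a sum of extended nonnegative reals. -/
noncomputable def extInterference (g : ℝ → ℝ) (k : ℕ) (z : Plane) (ω : N.Ω) : ℝ≥0∞ :=
  ∑' n, N.mark k z n ω * ENNReal.ofReal (g ‖N.node n ω - z‖)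

theorem measurable_ite_bool : Measurable fun b : Bool => if b = true then (1 : ℝ≥0∞) else 0 :=
  .of_discrete

theorem measurable_active (n k : ℕ) : Measurable (N.active n k) :=
  measurable_ite_bool.comp (N.measurable_transmits n k)

theorem measurable_mark (k : ℕ) (z : Plane) (n : ℕ) : Measurable (N.mark k z n) :=
  (N.measurable_active n k).mul (N.measurable_fading n z k).ennreal_ofReal

theorem lintegral_active (n k : ℕ) : ∫⁻ ω, N.active n k ω ∂N.P = ENNReal.ofReal p := by
  have hm : MeasurableSet {ω | N.transmits n k ω = true} :=
    N.measurable_transmits n k (measurableSet_singleton true)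
  rw [← N.prob_transmits n k, ← lintegral_indicator_one hm]
  congr 1 with ω
  simp [active, Set.indicator_apply]

theorem lintegral_active_mul_active {n k m l : ℕ} (h : (n, k) ≠ (m, l)) :
    ∫⁻ ω, N.active n k ω * N.active m l ω ∂N.P = ENNReal.ofReal p * ENNReal.ofReal p := by
  have := lintegral_mul_eq_lintegral_mul_lintegral_of_indepFun (N.measurable_active n k)
    (N.measurable_active m l)
    ((N.indep_transmits.indepFun h).comp measurable_ite_bool measurable_ite_bool)
  simpa [N.lintegral_active] using this

theorem lintegral_fading (hF : IsUnitMeanFading F) (n : ℕ) (z : Plane) (k : ℕ) :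
    ∫⁻ ω, ENNReal.ofReal (N.fading n z k ω) ∂N.P = 1 := by
  rw [← hF.lintegral_ofReal]
  exact (N.law_fading n z k).lintegral_comp (f := ENNReal.ofReal) (by fun_prop)

theorem lintegral_fading_mul_self (hF : IsUnitMeanFading F) (n : ℕ) (z : Plane) (k : ℕ) :
    ∫⁻ ω, ENNReal.ofReal (N.fading n z k ω) * ENNReal.ofReal (N.fading n z k ω) ∂N.P =
      ENNReal.ofReal (∫ x, x ^ 2 ∂F) := by
  rw [← hF.lintegral_ofReal_mul_self]
  exact (N.law_fading n z k).lintegral_comp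
    (f := fun x => ENNReal.ofReal x * ENNReal.ofReal x) (by fun_prop)

theorem lintegral_fading_mul_fading (hF : IsUnitMeanFading F) (z : Plane) {n k m l : ℕ}
    (h : (n, k) ≠ (m, l)) :
    ∫⁻ ω, ENNReal.ofReal (N.fading n z k ω) * ENNReal.ofReal (N.fading m z l ω) ∂N.P = 1 := by
  have h' : (n, z, k) ≠ (m, z, l) := by simpa using h
  have := lintegral_mul_eq_lintegral_mul_lintegral_of_indepFun
    (N.measurable_fading n z k).ennreal_ofReal (N.measurable_fading m z l).ennreal_ofReal
    ((N.indep_fading.indepFun h').comp ENNReal.measurable_ofReal ENNReal.measurable_ofReal)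
  simpa [N.lintegral_fading hF] using this

theorem lintegral_mark (hF : IsUnitMeanFading F) (k : ℕ) (z : Plane) (n : ℕ) :
    ∫⁻ ω, N.mark k z n ω ∂N.P = ENNReal.ofReal p := by
  have := lintegral_mul_eq_lintegral_mul_lintegral_of_indepFun (N.measurable_active n k)
    (N.measurable_fading n z k).ennreal_ofReal
    (N.indep_transmits_fading.comp
      (φ := fun t : ℕ → ℕ → Bool => if t n k = true then (1 : ℝ≥0∞) else 0)
      (ψ := fun h : ℕ → Plane → ℕ → ℝ => ENNReal.ofReal (h n z k))
      (measurable_ite_bool.comp (by fun_prop)) (by fun_prop))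
  rw [N.lintegral_fading hF, N.lintegral_active, mul_one] at this
  exact this

theorem lintegral_mark_mul_mark_eq (k l : ℕ) (z : Plane) (n m : ℕ) :
    ∫⁻ ω, N.mark k z n ω * N.mark l z m ω ∂N.P =
      (∫⁻ ω, N.active n k ω * N.active m l ω ∂N.P) *
        ∫⁻ ω, ENNReal.ofReal (N.fading n z k ω) * ENNReal.ofReal (N.fading m z l ω) ∂N.P := by
  simp only [mark]
  rw [lintegral_congr fun ω => mul_mul_mul_comm _ _ _ _]
  exact lintegral_mul_eq_lintegral_mul_lintegral_of_indepFun
    ((N.measurable_active n k).mul (N.measurable_active m l))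
    ((N.measurable_fading n z k).ennreal_ofReal.mul (N.measurable_fading m z l).ennreal_ofReal)
    (N.indep_transmits_fading.comp
      (φ := fun t : ℕ → ℕ → Bool => (if t n k = true then (1 : ℝ≥0∞) else 0) *
        if t m l = true then (1 : ℝ≥0∞) else 0)
      (ψ := fun h : ℕ → Plane → ℕ → ℝ => ENNReal.ofReal (h n z k) * ENNReal.ofReal (h m z l))
      ((measurable_ite_bool.comp (by fun_prop)).mul (measurable_ite_bool.comp (by fun_prop)))
      (by fun_prop))

/-- Differing in node or in slot suffices, so this serves both the off-diagonal terms and one node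
in two slots. -/
theorem lintegral_mark_mul_mark (hF : IsUnitMeanFading F) (z : Plane) {n k m l : ℕ}
    (h : (n, k) ≠ (m, l)) :
    ∫⁻ ω, N.mark k z n ω * N.mark l z m ω ∂N.P = ENNReal.ofReal p * ENNReal.ofReal p := by
  rw [N.lintegral_mark_mul_mark_eq, N.lintegral_active_mul_active h,
    N.lintegral_fading_mul_fading hF z h, mul_one]

/-- The transmission indicator is its own square, so only one factor `p` appears. -/
theorem lintegral_mark_mul_self (hF : IsUnitMeanFading F) (k : ℕ) (z : Plane) (n : ℕ) :
    ∫⁻ ω, N.mark k z n ω * N.mark k z n ω ∂N.P =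
      ENNReal.ofReal p * ENNReal.ofReal (∫ x, x ^ 2 ∂F) := by
  rw [N.lintegral_mark_mul_mark_eq, N.lintegral_fading_mul_self hF, ← N.lintegral_active n k]
  simp [active, ← ite_and]

theorem indepFun_node_mark (k l : ℕ) (z : Plane) :
    IndepFun (fun ω n => N.node n ω) (fun ω n => (N.mark k z n ω, N.mark l z n ω)) N.P :=
  N.indep_node.comp (φ := id)
    (ψ := fun u : (ℕ → ℕ → Bool) × (ℕ → Plane → ℕ → ℝ) => fun n =>
      ((if u.1 n k = true then (1 : ℝ≥0∞) else 0) * ENNReal.ofReal (u.2 n z k),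
        (if u.1 n l = true then (1 : ℝ≥0∞) else 0) * ENNReal.ofReal (u.2 n z l)))
    measurable_id (measurable_pi_lambda _ fun n =>
      ((measurable_ite_bool.comp (by fun_prop)).mul (by fun_prop)).prodMk
        ((measurable_ite_bool.comp (by fun_prop)).mul (by fun_prop)))

/-! ### Moments and correlation of the interference. -/

section Interference

variable {g : ℝ → ℝ}

theorem measurable_extInterference (hg : IsPathLoss g) (k : ℕ) (z : Plane) :
    Measurable (N.extInterference g k z) :=
  Measurable.tsum fun n => (N.measurable_mark k z n).mul
    (hg.measurable_ofReal_norm.comp ((N.poisson.measurable n).sub_const z))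

theorem lintegral_extInterference (hF : IsUnitMeanFading F) (hg : IsPathLoss g) (k : ℕ)
    (z : Plane) :
    ∫⁻ ω, N.extInterference g k z ω ∂N.P =
      ENNReal.ofReal p * (lam * ∫⁻ x : Plane, ENNReal.ofReal (g ‖x‖)) := by
  have hm : Measurable fun x : Plane => ENNReal.ofReal (g ‖x - z‖) :=
    hg.measurable_ofReal_norm.comp (measurable_sub_const z)
  have := N.poisson.lintegral_tsum_mul hm (N.measurable_mark k z) (N.lintegral_mark hF k z)
    ((N.indepFun_node_mark k k z).comp measurable_id
      (ψ := fun u : ℕ → ℝ≥0∞ × ℝ≥0∞ => fun n => (u n).1) (by fun_prop))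
  -- Translation invariance of Lebesgue measure removes the dependence on `z`.
  rw [lintegral_smul_measure,
    lintegral_sub_right_eq_self (fun x : Plane => ENNReal.ofReal (g ‖x‖)) z] at this
  exact this

theorem lintegral_extInterference_mul (hF : IsUnitMeanFading F) (hg : IsPathLoss g) {k l : ℕ}
    (z : Plane) {β : ℝ≥0∞} (hβ : ∀ n, ∫⁻ ω, N.mark k z n ω * N.mark l z n ω ∂N.P = β) :
    ∫⁻ ω, N.extInterference g k z ω * N.extInterference g l z ω ∂N.P =
      β * (lam * ∫⁻ x : Plane, ENNReal.ofReal (g ‖x‖) * ENNReal.ofReal (g ‖x‖)) +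
        (ENNReal.ofReal p * (lam * ∫⁻ x : Plane, ENNReal.ofReal (g ‖x‖))) *
          (ENNReal.ofReal p * (lam * ∫⁻ x : Plane, ENNReal.ofReal (g ‖x‖))) := by
  have hm : Measurable fun x : Plane => ENNReal.ofReal (g ‖x - z‖) :=
    hg.measurable_ofReal_norm.comp (measurable_sub_const z)
  have := N.poisson.lintegral_tsum_mul_mul_tsum_mul hm (N.measurable_mark k z)
    (N.measurable_mark l z) hβ
    (fun n m hnm => N.lintegral_mark_mul_mark hF z (by simp [hnm])) (N.indepFun_node_mark k l z)
  rw [lintegral_smul_measure, lintegral_smul_measure,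
    lintegral_sub_right_eq_self (fun x : Plane => ENNReal.ofReal (g ‖x‖)) z,
    lintegral_sub_right_eq_self
      (fun x : Plane => ENNReal.ofReal (g ‖x‖) * ENNReal.ofReal (g ‖x‖)) z] at this
  rw [mul_mul_mul_comm]
  exact this

theorem lintegral_extInterference_ne_top (hF : IsUnitMeanFading F) (hg : IsPathLoss g) (k : ℕ)
    (z : Plane) : ∫⁻ ω, N.extInterference g k z ω ∂N.P ≠ ∞ := by
  rw [N.lintegral_extInterference hF hg]
  exact ENNReal.mul_ne_top ENNReal.ofReal_ne_top
    (ENNReal.mul_ne_top ENNReal.coe_ne_top hg.lintegral_ne_top)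

theorem lintegral_extInterference_mul_ne_top (hF : IsUnitMeanFading F) (hg : IsPathLoss g)
    {k l : ℕ} (z : Plane) {b : ℝ}
    (hβ : ∀ n, ∫⁻ ω, N.mark k z n ω * N.mark l z n ω ∂N.P = ENNReal.ofReal b) :
    ∫⁻ ω, N.extInterference g k z ω * N.extInterference g l z ω ∂N.P ≠ ∞ := by
  rw [N.lintegral_extInterference_mul hF hg z hβ, ← N.lintegral_extInterference hF hg k z]
  exact ENNReal.add_ne_top.2 ⟨ENNReal.mul_ne_top ENNReal.ofReal_ne_top
    (ENNReal.mul_ne_top ENNReal.coe_ne_top hg.lintegral_mul_self_ne_top),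
    ENNReal.mul_ne_top (N.lintegral_extInterference_ne_top hF hg k z)
      (N.lintegral_extInterference_ne_top hF hg k z)⟩

/-- A finite mean makes the extended sum finite almost surely; fading is almost surely nonnegative
at all nodes at once, so the real and extended terms agree. -/
theorem ae_summable_received (hF : IsUnitMeanFading F) (hg : IsPathLoss g) (k : ℕ) (z : Plane) :
    ∀ᵐ ω ∂N.P, Summable (fun n => N.received g k z n ω) ∧
      N.interference g k z ω = (N.extInterference g k z ω).toReal := by
  have hpos : ∀ᵐ ω ∂N.P, ∀ n, 0 ≤ N.fading n z k ω := ae_all_iff.2 fun n =>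
    ((N.law_fading n z k).ae_iff (p := fun x => 0 ≤ x)
      (measurableSet_setOfPred.1 measurableSet_Ici)).2 hF.nonneg
  filter_upwards [ae_lt_top (N.measurable_extInterference hg k z)
    (N.lintegral_extInterference_ne_top hF hg k z), hpos] with ω hω hω0
  have hrec : ∀ n, N.received g k z n ω =
      (N.mark k z n ω * ENNReal.ofReal (g ‖N.node n ω - z‖)).toReal := by
    intro n
    have := hg.nonneg _ (norm_nonneg (N.node n ω - z))
    by_cases h : N.transmits n k ω = true <;> simp [received, mark, active, h, hω0 n, this]
  simp only [interference, hrec]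
  refine ⟨ENNReal.summable_toReal hω.ne, ?_⟩
  rw [extInterference, ENNReal.tsum_toReal_eq fun n => ENNReal.ne_top_of_tsum_ne_top hω.ne n]

theorem interference_ae_eq (hF : IsUnitMeanFading F) (hg : IsPathLoss g) (k : ℕ) (z : Plane) :
    N.interference g k z =ᵐ[N.P] fun ω => (N.extInterference g k z ω).toReal :=
  (N.ae_summable_received hF hg k z).mono fun _ h => h.2

theorem lintegral_mark_mul_self_eq_ofReal (hp : 0 ≤ p) (hF : IsUnitMeanFading F) (k : ℕ)
    (z : Plane) (n : ℕ) : ∫⁻ ω, N.mark k z n ω * N.mark k z n ω ∂N.P =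
      ENNReal.ofReal (p * ∫ x, x ^ 2 ∂F) := by
  rw [N.lintegral_mark_mul_self hF, ENNReal.ofReal_mul hp]

theorem memLp_interference (hp : 0 ≤ p) (hF : IsUnitMeanFading F) (hg : IsPathLoss g) (k : ℕ)
    (z : Plane) : MemLp (N.interference g k z) 2 N.P :=
  (memLp_congr_ae (N.interference_ae_eq hF hg k z)).2
    (memLp_two_toReal (N.measurable_extInterference hg k z).aemeasurable
      (N.lintegral_extInterference_mul_ne_top hF hg z
        (N.lintegral_mark_mul_self_eq_ofReal hp hF k z)))

/-- The off-diagonal part of the mixed moment is the product of the means; only the same-node mark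
moment `b` survives. -/
theorem covariance_interference (hp : 0 ≤ p) (hF : IsUnitMeanFading F) (hg : IsPathLoss g)
    {k l : ℕ} (z : Plane) {b : ℝ} (hb : 0 ≤ b)
    (hβ : ∀ n, ∫⁻ ω, N.mark k z n ω * N.mark l z n ω ∂N.P = ENNReal.ofReal b) :
    cov[N.interference g k z, N.interference g l z; N.P] =
      b * (lam * (∫⁻ x : Plane, ENNReal.ofReal (g ‖x‖) * ENNReal.ofReal (g ‖x‖)).toReal) := by
  have hself := fun k => N.lintegral_extInterference_mul_ne_top hF hg z
    (N.lintegral_mark_mul_self_eq_ofReal hp hF k z)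
  have h1 := fun k => N.lintegral_extInterference_ne_top hF hg k z
  rw [covariance_congr_ae (N.interference_ae_eq hF hg k z) (N.interference_ae_eq hF hg l z),
    covariance_toReal (N.measurable_extInterference hg k z).aemeasurable
      (N.measurable_extInterference hg l z).aemeasurable (hself k) (hself l)
      (N.lintegral_extInterference_mul_ne_top hF hg z hβ) (h1 k) (h1 l),
    N.lintegral_extInterference_mul hF hg z hβ, N.lintegral_extInterference hF hg,
    N.lintegral_extInterference hF hg, ENNReal.toReal_add, ENNReal.toReal_mul, ENNReal.toReal_mul,
    ENNReal.toReal_mul (a := _ * _), ENNReal.toReal_ofReal hb, ENNReal.coe_toReal,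
    add_sub_cancel_right]
  · exact ENNReal.mul_ne_top ENNReal.ofReal_ne_top
      (ENNReal.mul_ne_top ENNReal.coe_ne_top hg.lintegral_mul_self_ne_top)
  · rw [← N.lintegral_extInterference hF hg k z]
    exact ENNReal.mul_ne_top (h1 k) (h1 k)

theorem hasTemporalCorrelation (hlam : 0 < lam) (hp : 0 < p) (hF : IsUnitMeanFading F)
    (hg : IsPathLoss g) (hg0 : ∃ r, 0 < r ∧ 0 < g r) :
    N.HasTemporalCorrelation g (p / ∫ x, x ^ 2 ∂F) := by
  intro z
  have hF2 : 0 < ∫ x, x ^ 2 ∂F := zero_lt_one.trans_le hF.one_le_integral_sq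
  set B := lam * (∫⁻ x : Plane, ENNReal.ofReal (g ‖x‖) * ENNReal.ofReal (g ‖x‖)).toReal with hB
  have hBpos : 0 < B := mul_pos hlam
    (ENNReal.toReal_pos (hg.lintegral_mul_self_pos hg0).ne' hg.lintegral_mul_self_ne_top)
  have hvar : ∀ k, Var[N.interference g k z; N.P] = p * (∫ x, x ^ 2 ∂F) * B := fun k => by
    rw [← covariance_self (N.memLp_interference hp.le hF hg k z).aemeasurable,
      N.covariance_interference hp.le hF hg z (by positivity)
        (N.lintegral_mark_mul_self_eq_ofReal hp.le hF k z)]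
  refine ⟨fun k => ⟨(N.ae_summable_received hF hg k z).mono fun _ h => h.1,
    N.memLp_interference hp.le hF hg k z, by rw [hvar]; positivity⟩, fun k l hkl => ?_⟩
  -- The variance does not depend on the slot, so the denominator is `p 𝔼[h²] B`, against the
  -- covariance `p² B`.
  rw [correlation, hvar, hvar, Real.mul_self_sqrt (by positivity),
    N.covariance_interference hp.le hF hg z (b := p * p) (by positivity) fun n => by
      rw [N.lintegral_mark_mul_mark hF z (by simp [hkl]), ENNReal.ofReal_mul hp.le], ← hB]
  field_simp

end Interference

end AlohaNetwork

/-! ### Gamma moments and the special fading laws. -/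

/-- Multiplying the density by `x ^ k` raises the shape from `a` to `a + k`, leaving a Gamma
integral. -/
theorem integral_pow_gammaMeasure {a r : ℝ} (ha : 0 < a) (hr : 0 < r) (k : ℕ) :
    ∫ x, x ^ k ∂gammaMeasure a r = Real.Gamma (a + k) / Real.Gamma a / r ^ k := by
  have hpdf : gammaPDF a r = fun x => ((gammaPDFReal a r x).toNNReal : ℝ≥0∞) := rfl
  rw [gammaMeasure, hpdf, integral_withDensity_eq_integral_smul (by fun_prop)]
  have hint : ∀ x : ℝ, (gammaPDFReal a r x).toNNReal • x ^ k =
      (Set.Ici 0).indicator (fun x : ℝ => gammaPDFReal a r x * x ^ k) x := by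
    intro x
    rw [NNReal.smul_def, Real.coe_toNNReal _ (gammaPDFReal_nonneg ha hr x), smul_eq_mul]
    by_cases hx : 0 ≤ x <;> simp [hx, gammaPDFReal]
  simp_rw [hint]
  rw [integral_indicator measurableSet_Ici, integral_Ici_eq_integral_Ioi]
  have hset : ∫ x in Set.Ioi 0, gammaPDFReal a r x * x ^ k =
      ∫ x in Set.Ioi 0, r ^ a / Real.Gamma a * (x ^ (a + k - 1) * Real.exp (-(r * x))) := by
    refine setIntegral_congr_fun measurableSet_Ioi fun x hx => ?_
    have hx : 0 < x := hx
    have : x ^ (a + k - 1) = x ^ (a - 1) * x ^ k := by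
      rw [← Real.rpow_natCast, ← Real.rpow_add hx]; ring_nf
    simp only [gammaPDFReal, if_pos hx.le, this]
    ring
  rw [hset, integral_const_mul, Real.integral_rpow_mul_exp_neg_mul_Ioi (by positivity) hr,
    Real.div_rpow zero_le_one hr.le, Real.one_rpow, Real.rpow_add hr, Real.rpow_natCast]
  have := (Real.rpow_pos_of_pos hr a).ne'
  have := (Real.Gamma_pos_of_pos ha).ne'
  field_simp

theorem integral_sq_nakagamiPower {m : ℝ} (hm : 0 < m) :
    ∫ x, x ^ 2 ∂nakagamiPower m = (m + 1) / m := by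
  have := (Real.Gamma_pos_of_pos hm).ne'
  rw [nakagamiPower, integral_pow_gammaMeasure hm hm, Nat.cast_two, ← one_add_one_eq_two,
    ← add_assoc, Real.Gamma_add_one (by positivity), Real.Gamma_add_one hm.ne']
  field_simp

theorem isUnitMeanFading_nakagamiPower {m : ℝ} (hm : 0 < m) :
    IsUnitMeanFading (nakagamiPower m) where
  prob := isProbabilityMeasure_gammaMeasure hm hm
  nonneg := by
    rw [nakagamiPower, gammaMeasure,
      ae_withDensity_iff (μ := volume) (f := gammaPDF m m)
        (measurable_gammaPDFReal m m).ennreal_ofReal]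
    refine ae_of_all _ fun x hx => ?_
    contrapose! hx
    exact gammaPDF_of_neg hx
  mean := by
    have := (Real.Gamma_pos_of_pos hm).ne'
    have h := integral_pow_gammaMeasure hm hm 1
    simp only [pow_one, Nat.cast_one, Real.Gamma_add_one hm.ne'] at h
    rw [nakagamiPower, h]
    field_simp
  memLp := by
    -- The Bochner integral of a non-integrable function is zero, so the nonzero value `(m + 1) / m`
    -- already proves integrability.
    refine (memLp_two_iff_integrable_sq aestronglyMeasurable_id).2
      (Integrable.of_integral_ne_zero ?_)
    simp only [id_eq]
    rw [integral_sq_nakagamiPower hm]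
    positivity

theorem isUnitMeanFading_noFading : IsUnitMeanFading noFading where
  prob := by unfold noFading; infer_instance
  nonneg := by simp [noFading, ae_dirac_eq]
  mean := by simp [noFading]
  memLp := by
    refine (memLp_two_iff_integrable_sq aestronglyMeasurable_id).2 ?_
    simp [noFading, integrable_dirac]

theorem AlohaNetwork.hasTemporalCorrelation_nakagamiPower {lam : ℝ≥0} (hlam : 0 < lam) {p : ℝ}
    (hp : 0 < p) {g : ℝ → ℝ} (hg : IsPathLoss g) (hg0 : ∃ r, 0 < r ∧ 0 < g r) {m : ℝ} (hm : 0 < m)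
    (N : AlohaNetwork lam p (nakagamiPower m)) :
    N.HasTemporalCorrelation g (p * m / (m + 1)) := by
  have := N.hasTemporalCorrelation hlam hp (isUnitMeanFading_nakagamiPower hm) hg hg0
  rwa [integral_sq_nakagamiPower hm, div_div_eq_mul_div] at this

theorem corollary1 (lam : ℝ≥0) (hlam : 0 < lam) (p : ℝ) (hp0 : 0 < p) (hp1 : p ≤ 1)
    (g : ℝ → ℝ) (hg : IsPathLoss g) (hg0 : ∃ r, 0 < r ∧ 0 < g r) :
    (∀ F : Measure ℝ, IsUnitMeanFading F → ∀ N : AlohaNetwork lam p F,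
      N.HasTemporalCorrelation g (p / ∫ x, x ^ 2 ∂F)) ∧
    (∀ m : ℝ, 0 < m → ∀ N : AlohaNetwork lam p (nakagamiPower m),
      N.HasTemporalCorrelation g (p * m / (m + 1))) ∧
    (∀ N : AlohaNetwork lam p rayleighPower, N.HasTemporalCorrelation g (p / 2)) ∧
    (∀ N : (m : Set.Ioi (0 : ℝ)) → AlohaNetwork lam p (nakagamiPower m),
      ∀ (z : Plane) (k l : ℕ), k ≠ l →
        Tendsto (fun m => (N m).correlation g k l z z) atTop (𝓝 p)) ∧
    (∀ N : AlohaNetwork lam p noFading, N.HasTemporalCorrelation g p) := by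
  refine ⟨fun F hF N => N.hasTemporalCorrelation hlam hp0 hF hg hg0,
    fun m hm N => N.hasTemporalCorrelation_nakagamiPower hlam hp0 hg hg0 hm, fun N => ?_,
    fun N z k l hkl => ?_, fun N => ?_⟩
  -- `expMeasure 1` unfolds to `gammaMeasure 1 1`, so Rayleigh fading is definitionally the case `m
  -- = 1`.
  · have := AlohaNetwork.hasTemporalCorrelation_nakagamiPower hlam hp0 hg hg0 one_pos N
    rwa [mul_one, one_add_one_eq_two] at this
  · simp_rw [fun m : Set.Ioi (0 : ℝ) =>
      ((N m).hasTemporalCorrelation_nakagamiPower hlam hp0 hg hg0 m.2 z).2 k l hkl]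
    rw [tendsto_comp_val_Ioi_atTop (f := fun m : ℝ => p * m / (m + 1))]
    -- Uses `m / (m + 1) = 1 - (m + 1)⁻¹`.
    have h : Tendsto (fun m : ℝ => p * (1 - (m + 1)⁻¹)) atTop (𝓝 (p * (1 - 0))) :=
      ((tendsto_inv_atTop_zero.comp
        (tendsto_atTop_add_const_right _ 1 tendsto_id)).const_sub 1).const_mul p
    rw [sub_zero, mul_one] at h
    refine h.congr' ((eventually_gt_atTop 0).mono fun m hm => ?_)
    field_simp
    ring
  · have := N.hasTemporalCorrelation hlam hp0 isUnitMeanFading_noFading hg hg0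
    simpa [noFading] using this
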